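/- Let $X$ be a complete metric space and let $S:[0,\infty)\times X\to X$ be a continuous semiflow ($S(0)x=x$, $S(t+s)x=S(t)S(s)x$) which is asymptotically compact: whenever $(x_n)$ is a bounded sequence in $X$, $t_n\to\infty$ and $(S(t_n)x_n)$ is bounded, then $(S(t_n)x_n)$ has a convergent subsequence. An attractor is a compact set $A$ with $S(t)A=A$ for all $t\ge 0$ which attracts a neighbourhood $U$ of itself, that is, for every $\varepsilon>0$ the set $S(t)U$ lies in the $\varepsilon$-neighbourhood of $A$ for all large $t$. Let $\mathscr A$ be an attractor with attraction basin $\Omega=\{x\in X : \lim_{t\to\infty}d(S(t)x,\mathscr A)=0\}$. Let $\mathcal M=\{M_1,\dots,M_l\}$ be a Morse decomposition of $\mathscr A$: there are attractors $\emptyset=A_0\subsetneq A_1\subsetneq\cdots\subsetneq A_l=\mathscr A$ of the restriction of $S$ to $\mathscr A$ such that $M_k=A_k\cap A_{k-1}^*$ for $1\le k\le l$, where $A^*=\{x\in\mathscr A : \omega(x)\cap A=\emptyset\}$. Let $V:\Omega\to\mathbb R$ be a strict Morse-Lyapunov function of $\mathcal M$: $V$ is continuous, $V$ is constant on each $M_k$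 with value $c_k$, $c_1<c_2<\cdots<c_l$, and for $x\in\Omega\setminus\bigcup_k M_k$ the function $t\mapsto V(S(t)x)$ is strictly decreasing (as long as $S(t)x\notin\bigcup_k M_k$), i.e. $V(S(t)x)<V(x)$ for all $t>0$. For $r\in\mathbb R$ put $V_r=\{x\in\Omega : V(x)\le r\}$. Let $R$ be an integral domain, $\mathscr G$ an $R$-module (for instance $R=\mathbb Z$ and $\mathscr G$ any abelian group), let $H_*$ denote singular homology with coefficients in $\mathscr G$, and let rank mean the rank of an $R$-module (the maximal number of linearly independent elements). For each $k$ choose numbers $a_k<c_k<b_k$ such that $c_k$ is the only one of $c_1,\dots,c_l$ in $[a_k,b_k]$, and let $C_q(M_k)=H_q(V_{b_k},V_{a_k})$, $q=0,1,\dots$, be the critical groups of $M_k$. Let $m_q=\sum_{k=1}^l\operatorname{rank}C_q(M_k)$. Let $b\in\mathbb R$ with $b>c_k$ for all $k$, and let $\beta_q=\operatorname{rank}H_q(V_b)$. Suppose that $\operatorname{rank}C_q(M_k)<\infty$ for all $q\ge 0$ and $1\le k\le l$. Then every $\beta_q$ is finite, and for every $q\ge0$ $$m_q-m_{q-1}+\cdots+(-1)^qm_0\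 \ge\ \beta_q-\beta_{q-1}+\cdots+(-1)^q\beta_0 .$$ Moreover, $$\sum_{q=0}^\infty(-1)^qm_q=\sum_{q=0}^\infty(-1)^q\beta_q ,$$ provided that the series on the left-hand side converges (the series on the right then converges too). -/

import Mathlib

open Set Filter Topology CategoryTheory
open scoped NNReal Cardinal

universe u v

noncomputable section

namespace MorseAttractor

section Dynamics

variable {X : Type u} [MetricSpace X]

/-- Asymptotic compactness of a semiflow `S : ℝ≥0 × X → X`: if `x n` is a bounded sequence,
`t n → ∞`, and `S (t n) (x n)` is bounded, then `S (t n) (x n)` has a convergent subsequence. -/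
def AsymptoticallyCompact (S : Flow ℝ≥0 X) : Prop :=
  ∀ (x : ℕ → X) (t : ℕ → ℝ≥0), Bornology.IsBounded (range x) → Tendsto t atTop atTop →
    Bornology.IsBounded (range fun n => S (t n) (x n)) →
    ∃ (y : X) (φ : ℕ → ℕ), StrictMono φ ∧ Tendsto (fun n => S (t (φ n)) (x (φ n))) atTop (𝓝 y)

/-- `A` attracts `B`: for every `ε > 0`, `S t B` lies in the `ε`-neighbourhood of `A` for all
sufficiently large `t`. -/
def Attracts (S : Flow ℝ≥0 X) (A B : Set X) : Prop :=
  ∀ ε : ℝ, 0 < ε → ∃ T : ℝ≥0, ∀ t : ℝ≥0, T < t → S t '' B ⊆ Metric.thickening ε A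

/-- An attractor: a compact set, invariant (`S t A = A` for all `t ≥ 0`), which attracts a
neighbourhood of itself. -/
structure IsAttractor (S : Flow ℝ≥0 X) (A : Set X) : Prop where
  isCompact : IsCompact A
  invariant : ∀ t : ℝ≥0, S t '' A = A
  attracts_nhds : ∃ U ∈ 𝓝ˢ A, Attracts S A U

/-- The attraction basin `{x | d(S t x, A) → 0 as t → ∞}`. The distance is taken with values in
`[0, ∞]`, so that the basin of the empty set is empty. -/
def basin (S : Flow ℝ≥0 X) (A : Set X) : Set X :=
  {x | Tendsto (fun t : ℝ≥0 => Metric.infEDist (S t x) A) atTop (𝓝 0)}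

/-- `A` is an attractor of `S` in `𝒜`: `A ⊆ 𝒜` is an attractor of the restriction of `S` to the
metric subspace `𝒜`. -/
def IsAttractorIn (S : Flow ℝ≥0 X) (𝒜 A : Set X) : Prop :=
  ∃ h : IsInvariant S.toFun 𝒜, A ⊆ 𝒜 ∧
    IsAttractor (S.restrict h) ((Subtype.val : 𝒜 → X) ⁻¹' A)

/-- The repeller `A* = {x ∈ 𝒜 | ω(x) ∩ A = ∅}` in `𝒜` dual to `A`. -/
def dualRepeller (S : Flow ℝ≥0 X) (𝒜 A : Set X) : Set X :=
  {x ∈ 𝒜 | omegaLimit atTop S.toFun {x} ∩ A = ∅}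

/-- `M 0, …, M (l-1)` is a Morse decomposition of `𝒜`: there is a strictly increasing sequence
`∅ = A 0 ⊊ A 1 ⊊ … ⊊ A l = 𝒜` of attractors of `S` in `𝒜` such that the `k`-th Morse set is the
intersection of the `k`-th attractor with the repeller dual to the preceding attractor. -/
def IsMorseDecomposition (S : Flow ℝ≥0 X) (𝒜 : Set X) {l : ℕ} (M : Fin l → Set X) : Prop :=
  ∃ A : Fin (l + 1) → Set X,
    A 0 = ∅ ∧ A (Fin.last l) = 𝒜 ∧ StrictMono A ∧ (∀ i, IsAttractorIn S 𝒜 (A i)) ∧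
      ∀ k : Fin l, M k = A k.succ ∩ dualRepeller S 𝒜 (A k.castSucc)

/-- `V` (considered on the basin `Ω` of `𝒜` only) is a Morse-Lyapunov function: it is continuous
on `Ω`, constant on each Morse set, and decreases strictly along the orbit of every point of `Ω`
outside the Morse sets. Applied to all points of such an orbit, the last condition says that
`t ↦ V (S t x)` is strictly decreasing as long as the orbit has not entered a Morse set (where
`V` is constant); if the orbit never enters a Morse set, then it is strictly decreasing on the
whole of `[0, ∞)`. -/
structure IsMorseLyapunov (S : Flow ℝ≥0 X) (𝒜 : Set X) {l : ℕ} (M : Fin l → Set X)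
    (V : X → ℝ) : Prop where
  continuousOn : ContinuousOn V (basin S 𝒜)
  const : ∀ k, ∀ x ∈ M k, ∀ y ∈ M k, V x = V y
  decreasing : ∀ x ∈ basin S 𝒜, x ∉ ⋃ k, M k → ∀ t : ℝ≥0, 0 < t → V (S t x) < V x

/-- `V` is a strict Morse-Lyapunov function with generalized critical values
`c 0 < … < c (l-1)`, where `c k` is the value of `V` on the `k`-th Morse set. -/
structure IsStrictMorseLyapunov (S : Flow ℝ≥0 X) (𝒜 : Set X) {l : ℕ} (M : Fin l → Set X)
    (V : X → ℝ) (c : Fin l → ℝ) : Prop extends IsMorseLyapunov S 𝒜 M V where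
  value : ∀ k, ∀ x ∈ M k, V x = c k
  strictMono : StrictMono c

/-- The level set `V_r = {x ∈ Ω | V x ≤ r}` in the basin `Ω` of `𝒜`. -/
def level (S : Flow ℝ≥0 X) (𝒜 : Set X) (V : X → ℝ) (r : ℝ) : Set X :=
  {x ∈ basin S 𝒜 | V x ≤ r}

theorem level_mono (S : Flow ℝ≥0 X) (𝒜 : Set X) (V : X → ℝ) {r s : ℝ} (h : r ≤ s) :
    level S 𝒜 V r ⊆ level S 𝒜 V s :=
  fun _ hx => ⟨hx.1, hx.2.trans h⟩

/-- `a < c k < b`, and `c k` is the only generalized critical value in `[a, b]`. -/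
def Isolates {l : ℕ} (c : Fin l → ℝ) (k : Fin l) (a b : ℝ) : Prop :=
  a < c k ∧ c k < b ∧ ∀ j, c j ∈ Icc a b → c j = c k

theorem Isolates.le {l : ℕ} {c : Fin l → ℝ} {k : Fin l} {a b : ℝ} (h : Isolates c k a b) :
    a ≤ b :=
  (h.1.trans h.2.1).le

end Dynamics

section Homology

variable (R : Type v) [CommRing R] (G : Type u) [AddCommGroup G] [Module R G]
variable {X : Type u} [TopologicalSpace X]

/-- The singular chain complex of a subspace `A ⊆ X` with coefficients in `G`. -/
def chains (A : Set X) : ChainComplex (ModuleCat.{u} R) ℕ :=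
  ((AlgebraicTopology.singularChainComplexFunctor.{u} (ModuleCat.{u} R)).obj
    (ModuleCat.of R G)).obj (TopCat.of A)

/-- The chain map induced by an inclusion of subspaces. -/
def chainsMap {A B : Set X} (h : A ⊆ B) : chains R G A ⟶ chains R G B :=
  ((AlgebraicTopology.singularChainComplexFunctor.{u} (ModuleCat.{u} R)).obj
    (ModuleCat.of R G)).map
      (TopCat.ofHom ⟨Set.inclusion h, continuous_inclusion h⟩ : TopCat.of A ⟶ TopCat.of B)

/-- The singular homology `H_q(A; G)` of a subspace `A ⊆ X`. -/
def homology (q : ℕ) (A : Set X) : ModuleCat.{u} R :=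
  ((AlgebraicTopology.singularHomologyFunctor.{u} (ModuleCat.{u} R) q).obj
    (ModuleCat.of R G)).obj (TopCat.of A)

/-- The relative singular homology `H_q(B, A; G)` of a pair `A ⊆ B`: the homology of the quotient
of the singular chain complex of `B` by that of `A`. -/
def relHomology (q : ℕ) {A B : Set X} (h : A ⊆ B) : ModuleCat.{u} R :=
  (Limits.cokernel (chainsMap R G h)).homology q

end Homology

section Critical

variable (R : Type v) [CommRing R] (G : Type u) [AddCommGroup G] [Module R G]
variable {X : Type u} [MetricSpace X]

/-- The critical group `C_q(M_k) = H_q(V_b, V_a; G)` of the `k`-th Morse set, computed with a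
strict Morse-Lyapunov function `V` with generalized critical values `c` and an interval `[a, b]`
isolating `c k`. -/
def criticalGroup (S : Flow ℝ≥0 X) (𝒜 : Set X) (V : X → ℝ) {l : ℕ} {c : Fin l → ℝ} {k : Fin l}
    {a b : ℝ} (h : Isolates c k a b) (q : ℕ) : ModuleCat.{u} R :=
  relHomology R G q (level_mono S 𝒜 V h.le)

/-- The `q`-th Morse type number, the sum of the ranks of the critical groups `C_q(M_k)`. -/
def morseNumber (S : Flow ℝ≥0 X) (𝒜 : Set X) (V : X → ℝ) {l : ℕ} {c : Fin l → ℝ}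
    {a b : Fin l → ℝ} (h : ∀ k, Isolates c k (a k) (b k)) (q : ℕ) : ℕ :=
  ∑ k, Module.finrank R (criticalGroup R G S 𝒜 V (h k) q)

/-- `β_q`, the rank of `H_q(V_d; G)`. -/
def betti (S : Flow ℝ≥0 X) (𝒜 : Set X) (V : X → ℝ) (d : ℝ) (q : ℕ) : ℕ :=
  Module.finrank R (homology R G q (level S 𝒜 V d))

end Critical

end MorseAttractor

end

/-! Build `V_d` up through sublevel sets. Along an orbit in the basin `V` does not increase, and the
orbit accumulates at a point of `𝒜` where, by LaSalle's argument, `V` cannot drop any further. That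
point lies in a Morse set, so `V` tends to some `c k` (`IsStrictMorseLyapunov.exists_tendsto`).
Hence a sublevel set below all `c k` is empty, and between consecutive values the flow, run for a
continuously chosen time, deforms one sublevel set into another
(`IsStrictMorseLyapunov.rank_homology_level_eq`). Homology changes only from `V_{a k}` to `V_{b k}`.

Over a domain rank is additive on exact sequences, so the long exact sequence of a pair makes
alternating sums of ranks subadditive; the defect is the rank of the image of a connecting map
(`homology_rank_of_pair`). Induction over the critical values adds these inequalities up. The Morse
equation is then arithmetic of integer sequences. -/

namespace MorseAttractor

/-! ### Ranks in long exact sequences. -/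

section Algebra

variable {R : Type v} [CommRing R] [IsDomain R]

/-- Rank-nullity at the middle term of an exact sequence. -/
theorem rank_eq_rank_range_add_rank_range {L M N : Type u} [AddCommGroup L] [AddCommGroup M]
    [AddCommGroup N] [Module R L] [Module R M] [Module R N] (f : L →ₗ[R] M) (g : M →ₗ[R] N)
    (h : LinearMap.range f = LinearMap.ker g) :
    Module.rank R M = Module.rank R (LinearMap.range f) + Module.rank R (LinearMap.range g) := by
  rw [h, add_comm, LinearMap.rank_range_add_rank_ker]

/-- In the long exact homology sequence, the ranks of the images of the connecting maps, with
`ρ q` the rank of the image of the connecting map out of degree `q`. -/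
theorem exists_rank_homology_eq {T : ShortComplex (ChainComplex (ModuleCat.{u} R) ℕ)}
    (hT : T.ShortExact) :
    ∃ α ξ ρ : ℕ → Cardinal.{u}, ρ 0 = 0 ∧
      (∀ q, Module.rank R (T.X₁.homology q) = ρ (q + 1) + α q) ∧
      (∀ q, Module.rank R (T.X₂.homology q) = α q + ξ q) ∧
      (∀ q, Module.rank R (T.X₃.homology q) = ξ q + ρ q) := by
  have rel (q : ℕ) : (ComplexShape.down ℕ).Rel (q + 1) q := rfl
  refine ⟨fun q => Module.rank R (LinearMap.range (HomologicalComplex.homologyMap T.f q).hom),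
    fun q => Module.rank R (LinearMap.range (HomologicalComplex.homologyMap T.g q).hom),
    fun q => match q with
      | 0 => 0
      | q + 1 => Module.rank R (LinearMap.range (hT.δ (q + 1) q (rel q)).hom),
    rfl, fun q => ?_, fun q => ?_, fun q => ?_⟩
  · exact rank_eq_rank_range_add_rank_range _ _
      ((ShortComplex.moduleCat_exact_iff_range_eq_ker _).1 (hT.homology_exact₁ _ _ (rel q)))
  · exact rank_eq_rank_range_add_rank_range _ _
      ((ShortComplex.moduleCat_exact_iff_range_eq_ker _).1 (hT.homology_exact₂ q))
  · cases q with
    -- No connecting map leaves degree `0`: the sequence ends with a surjection, matching `ρ 0 = 0`.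
    | zero =>
      have : Epi T.g := hT.epi_g
      have : Epi (HomologicalComplex.homologyMap T.g 0) :=
        HomologicalComplex.epi_homologyMap_of_epi_of_not_rel _ _ (by simp)
      have hs := (ModuleCat.epi_iff_range_eq_top _).1 this
      simp only [add_zero]
      rw [hs, rank_top]
    | succ q =>
      exact rank_eq_rank_range_add_rank_range _ _
        ((ShortComplex.moduleCat_exact_iff_range_eq_ker _).1 (hT.homology_exact₃ _ _ (rel q)))

/-- Alternating partial sums `f q - f (q - 1) + ⋯ ± f 0`. -/
def alternatingSum (f : ℕ → ℤ) (q : ℕ) : ℤ :=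
  ∑ j ∈ Finset.range (q + 1), (-1 : ℤ) ^ (q - j) * f j

@[simp]
theorem alternatingSum_zero (f : ℕ → ℤ) : alternatingSum f 0 = f 0 := by
  simp [alternatingSum]

theorem alternatingSum_succ (f : ℕ → ℤ) (q : ℕ) :
    alternatingSum f (q + 1) = f (q + 1) - alternatingSum f q := by
  unfold alternatingSum
  rw [Finset.sum_range_succ, add_comm]
  simp only [Nat.sub_self, pow_zero, one_mul, sub_eq_add_neg, ← Finset.sum_neg_distrib]
  congr 1
  refine Finset.sum_congr rfl fun j hj => ?_
  rw [Nat.sub_add_comm (Finset.mem_range_succ_iff.1 hj), pow_succ]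
  ring

/-- The Morse inequality for one short exact sequence of chain complexes. -/
theorem homology_rank_of_shortExact {T : ShortComplex (ChainComplex (ModuleCat.{u} R) ℕ)}
    (hT : T.ShortExact) (h₁ : ∀ q, Module.rank R (T.X₁.homology q) < ℵ₀)
    (h₃ : ∀ q, Module.rank R (T.X₃.homology q) < ℵ₀) :
    (∀ q, Module.rank R (T.X₂.homology q) < ℵ₀) ∧
      ∀ q, alternatingSum (fun j => (Module.finrank R (T.X₂.homology j) : ℤ)) q ≤
        alternatingSum (fun j => (Module.finrank R (T.X₁.homology j) : ℤ)) q +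
        alternatingSum (fun j => (Module.finrank R (T.X₃.homology j) : ℤ)) q := by
  obtain ⟨α, ξ, ρ, hρ, e₁, e₂, e₃⟩ := exists_rank_homology_eq hT
  have hα q : α q < ℵ₀ := (le_add_self.trans_eq (e₁ q).symm).trans_lt (h₁ q)
  have hξ q : ξ q < ℵ₀ := (le_self_add.trans_eq (e₃ q).symm).trans_lt (h₃ q)
  have hρ' q : ρ q < ℵ₀ := (le_add_self.trans_eq (e₃ q).symm).trans_lt (h₃ q)
  refine ⟨fun q => e₂ q ▸ Cardinal.add_lt_aleph0 (hα q) (hξ q), fun q => ?_⟩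
  simp only [Module.finrank, e₁, e₂, e₃, Cardinal.toNat_add (hρ' _) (hα _),
    Cardinal.toNat_add (hα _) (hξ _), Cardinal.toNat_add (hξ _) (hρ' _)]
  -- The terms `ρ (j + 1) + ρ j` telescope under alternating signs, and `ρ 0 = 0` removes the lower
  -- end; the remainder `ρ (q + 1) ≥ 0` is the defect.
  have key : ∀ q, alternatingSum (fun j => ((Cardinal.toNat (ρ (j + 1)) +
        Cardinal.toNat (α j) : ℕ) : ℤ)) q +
      alternatingSum (fun j => ((Cardinal.toNat (ξ j) + Cardinal.toNat (ρ j) : ℕ) : ℤ)) q =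
      alternatingSum (fun j => ((Cardinal.toNat (α j) + Cardinal.toNat (ξ j) : ℕ) : ℤ)) q +
      Cardinal.toNat (ρ (q + 1)) := by
    intro q
    induction q with
    | zero => simp [hρ]; ring
    | succ q ih => simp only [alternatingSum_succ]; push_cast at ih ⊢; linarith
  have := key q
  linarith [Int.natCast_nonneg (Cardinal.toNat (ρ (q + 1)))]

end Algebra

/-! ### Singular homology of subspaces and pairs. -/

section Homology

variable (R : Type v) [CommRing R] (G : Type u) [AddCommGroup G] [Module R G]
variable {X : Type u} [TopologicalSpace X]

instance mono_chainsMap {A B : Set X} (h : A ⊆ B) : Mono (chainsMap R G h) := by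
  have : Mono (TopCat.ofHom ⟨Set.inclusion h, continuous_inclusion h⟩ :
      TopCat.of A ⟶ TopCat.of B) :=
    (TopCat.mono_iff_injective _).2 (Set.inclusion_injective h)
  exact ((AlgebraicTopology.singularChainComplexFunctor.{u} (ModuleCat.{u} R)).obj
    (ModuleCat.of R G)).map_mono _

/-- A subspace into which the ambient subspace can be deformed, while it stays in itself, has the
same homology. -/
theorem rank_homology_eq_of_homotopy {A B : Set X} (h : A ⊆ B) (H : C(unitInterval × B, B))
    (h₀ : ∀ x, H (0, x) = x) (h₁ : ∀ x, (H (1, x) : X) ∈ A)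
    (hA : ∀ t (x : B), (x : X) ∈ A → (H (t, x) : X) ∈ A) (q : ℕ) :
    Module.rank R (homology R G q A) = Module.rank R (homology R G q B) := by
  let F := (AlgebraicTopology.singularChainComplexFunctor.{u} (ModuleCat.{u} R)).obj
    (ModuleCat.of R G)
  let i : TopCat.of A ⟶ TopCat.of B := TopCat.ofHom ⟨Set.inclusion h, continuous_inclusion h⟩
  let r : TopCat.of B ⟶ TopCat.of A :=
    TopCat.ofHom ⟨fun x => ⟨H (1, x), h₁ x⟩, by fun_prop⟩
  let HB : TopCat.Homotopy (𝟙 (TopCat.of B)) (r ≫ i) :=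
    { toContinuousMap := H
      map_zero_left := h₀
      map_one_left := fun _ => rfl }
  -- Since the deformation preserves `A`, it restricts to `A`, which makes `r` a two-sided homotopy
  -- inverse of the inclusion.
  let HA : TopCat.Homotopy (𝟙 (TopCat.of A)) (i ≫ r) :=
    { toFun := fun p => ⟨H (p.1, Set.inclusion h p.2), hA _ _ p.2.2⟩
      continuous_toFun := by
        have := continuous_inclusion h
        fun_prop
      map_zero_left := fun x => by
        have := congrArg Subtype.val (h₀ (Set.inclusion h x))
        exact Subtype.ext (p := (· ∈ A)) this
      map_one_left := fun _ => rfl }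
  have eA := HA.congr_homologyMap_singularChainComplexFunctor (ModuleCat.of R G) q
  have eB := HB.congr_homologyMap_singularChainComplexFunctor (ModuleCat.of R G) q
  rw [CategoryTheory.Functor.map_id, CategoryTheory.Functor.map_comp, HomologicalComplex.homologyMap_id,
    HomologicalComplex.homologyMap_comp] at eA eB
  let e : homology R G q A ≅ homology R G q B :=
    { hom := HomologicalComplex.homologyMap (F.map i) q
      inv := HomologicalComplex.homologyMap (F.map r) q
      hom_inv_id := eA.symm
      inv_hom_id := eB.symm }
  exact e.toLinearEquiv.rank_eq

theorem rank_homology_empty [Nontrivial R] (q : ℕ) :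
    Module.rank R (homology R G q (∅ : Set X)) = 0 := by
  have : Limits.IsZero (homology R G q (∅ : Set X)) := by
    -- The empty space is totally disconnected: its higher homology vanishes and `H_0` is a
    -- coproduct over no points.
    rcases eq_or_ne q 0 with rfl | hq
    · refine Limits.IsZero.of_iso ?_
        (AlgebraicTopology.singularHomologyFunctorZeroOfTotallyDisconnectedSpace.{u}
          (ModuleCat.{u} R) (ModuleCat.of R G) (TopCat.of (∅ : Set X)))
      rw [Limits.IsZero.iff_id_eq_zero]
      exact Limits.Sigma.hom_ext _ _ fun x => x.2.elim
    · exact AlgebraicTopology.isZero_singularHomologyFunctor_of_totallyDisconnectedSpace.{u}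
        (ModuleCat.{u} R) q (ModuleCat.of R G) (TopCat.of (∅ : Set X)) hq
  have := ModuleCat.subsingleton_of_isZero this
  exact rank_subsingleton' R _

/-- The Morse inequality for one pair of subspaces. -/
theorem homology_rank_of_pair [IsDomain R] {A B : Set X} (h : A ⊆ B)
    (hA : ∀ q, Module.rank R (homology R G q A) < ℵ₀)
    (hAB : ∀ q, Module.rank R (relHomology R G q h) < ℵ₀) :
    (∀ q, Module.rank R (homology R G q B) < ℵ₀) ∧
      ∀ q, alternatingSum (fun j => (Module.finrank R (homology R G j B) : ℤ)) q ≤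
        alternatingSum (fun j => (Module.finrank R (homology R G j A) : ℤ)) q +
        alternatingSum (fun j => (Module.finrank R (relHomology R G j h) : ℤ)) q := by
  let T : ShortComplex (ChainComplex (ModuleCat.{u} R) ℕ) :=
    ShortComplex.mk (chainsMap R G h) (Limits.cokernel.π _) (Limits.cokernel.condition _)
  have hT : T.ShortExact :=
    { exact := ShortComplex.exact_cokernel _
      mono_f := mono_chainsMap R G h
      epi_g := inferInstanceAs (Epi (Limits.cokernel.π _)) }
  exact homology_rank_of_shortExact hT hA hAB

end Homology

end MorseAttractor

namespace MorseAttractor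

/-! ### Orbits in the basin and deformation of level sets. -/

section Dynamics

variable {X : Type u} [MetricSpace X] {S : Flow ℝ≥0 X} {𝒜 : Set X}

theorem map_mem_basin {x : X} (hx : x ∈ basin S 𝒜) (t : ℝ≥0) : S t x ∈ basin S 𝒜 := by
  have := hx.comp (tendsto_atTop_mono (fun s => le_self_add (a := s) (b := t)) tendsto_id)
  exact this.congr fun s => by simp only [Function.comp_apply, Flow.map_add]

theorem IsAttractor.map_mem (h : IsAttractor S 𝒜) {x : X} (hx : x ∈ 𝒜) (t : ℝ≥0) :
    S t x ∈ 𝒜 :=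
  h.invariant t ▸ mem_image_of_mem _ hx

theorem IsAttractor.subset_basin (h : IsAttractor S 𝒜) : 𝒜 ⊆ basin S 𝒜 := fun _ hx =>
  tendsto_const_nhds.congr fun t => (Metric.infEDist_zero_of_mem (h.map_mem hx t)).symm

theorem IsAttractorIn.map_mem {A : Set X} (h : IsAttractorIn S 𝒜 A) {x : X} (hx : x ∈ A)
    (t : ℝ≥0) : S t x ∈ A := by
  obtain ⟨hi, hA, h⟩ := h
  exact h.map_mem (x := ⟨x, hA hx⟩) hx t

theorem omegaLimit_map_subset (x : X) (t : ℝ≥0) :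
    omegaLimit atTop S.toFun {S t x} ⊆ omegaLimit atTop S.toFun {x} := by
  refine subset_iInter₂ fun u hu => ?_
  have hu' : (· + t) ⁻¹' u ∈ (atTop : Filter ℝ≥0) :=
    tendsto_atTop_mono (fun s => le_self_add (a := s) (b := t)) tendsto_id hu
  refine (iInter₂_subset _ hu').trans (closure_mono ?_)
  rintro _ ⟨s, hs, _, rfl, rfl⟩
  exact ⟨s + t, hs, x, rfl, S.map_add s t x⟩

theorem IsAttractor.map_mem_dualRepeller (h : IsAttractor S 𝒜) {A : Set X} {x : X}
    (hx : x ∈ dualRepeller S 𝒜 A) (t : ℝ≥0) : S t x ∈ dualRepeller S 𝒜 A :=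
  ⟨h.map_mem hx.1 t, subset_eq_empty (inter_subset_inter_left A (omegaLimit_map_subset x t)) hx.2⟩

variable {l : ℕ} {M : Fin l → Set X} {V : X → ℝ} {c : Fin l → ℝ}

/-- An orbit that enters a Morse set stays there, so `V` is constant from then on; this gives
monotonicity where strict decrease is not assumed. -/
theorem IsMorseDecomposition.map_mem (h : IsAttractor S 𝒜) (hM : IsMorseDecomposition S 𝒜 M)
    {k : Fin l} {x : X} (hx : x ∈ M k) (t : ℝ≥0) : S t x ∈ M k := by
  obtain ⟨A, -, -, -, hA, hMA⟩ := hM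
  rw [hMA] at hx ⊢
  exact ⟨(hA _).map_mem hx.1 t, h.map_mem_dualRepeller hx.2 t⟩

/-- A Morse-Lyapunov function does not increase along the orbits in the basin. -/
theorem IsMorseLyapunov.antitone (h : IsAttractor S 𝒜) (hM : IsMorseDecomposition S 𝒜 M)
    (hV : IsMorseLyapunov S 𝒜 M V) {x : X} (hx : x ∈ basin S 𝒜) :
    Antitone fun t : ℝ≥0 => V (S t x) := by
  have key : ∀ y ∈ basin S 𝒜, ∀ t : ℝ≥0, V (S t y) ≤ V y := by
    intro y hy t
    by_cases hyM : y ∈ ⋃ k, M k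
    · obtain ⟨k, hk⟩ := mem_iUnion.1 hyM
      exact (hV.const k _ (hM.map_mem h hk t) _ hk).le
    · rcases eq_or_ne t 0 with rfl | ht
      · simp
      · exact (hV.decreasing y hy hyM t (pos_iff_ne_zero.2 ht)).le
  intro s t hst
  have := key _ (map_mem_basin hx s) (t - s)
  rwa [← Flow.map_add, tsub_add_cancel_of_le hst] at this

/-- Orbits in the basin of a compact set accumulate at it. -/
theorem exists_tendsto_of_mem_basin (h : IsCompact 𝒜) {x : X} (hx : x ∈ basin S 𝒜) :
    ∃ y ∈ 𝒜, ∃ t : ℕ → ℝ≥0, Tendsto t atTop atTop ∧ Tendsto (fun n => S (t n) x) atTop (𝓝 y) := by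
  have hne : 𝒜.Nonempty := by
    rw [nonempty_iff_ne_empty]
    rintro rfl
    simp [basin] at hx
  -- Nearest points in the compact set subconverge, and the orbit approaches them.
  choose p hp hpd using fun n : ℕ => h.exists_infEDist_eq_edist hne (S n x)
  obtain ⟨y, hy, φ, hφ, hlim⟩ := h.tendsto_subseq hp
  have hφ' : Tendsto (fun n => (φ n : ℝ≥0)) atTop atTop :=
    tendsto_natCast_atTop_atTop.comp hφ.tendsto_atTop
  refine ⟨y, hy, fun n => φ n, hφ', ?_⟩
  refine (tendsto_iff_of_dist ?_).2 hlim
  have h0 : Tendsto (fun n => edist (S (φ n) x) (p (φ n))) atTop (𝓝 0) := by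
    simpa only [Function.comp_def, hpd] using hx.comp hφ'
  simpa [dist_edist, Function.comp_def] using (ENNReal.tendsto_toReal ENNReal.zero_ne_top).comp h0

/-- Along each orbit in the basin, `V` converges to a generalized critical value. -/
theorem IsStrictMorseLyapunov.exists_tendsto (h : IsAttractor S 𝒜)
    (hM : IsMorseDecomposition S 𝒜 M) (hV : IsStrictMorseLyapunov S 𝒜 M V c) {x : X}
    (hx : x ∈ basin S 𝒜) : ∃ k, c k ≤ V x ∧ Tendsto (fun t => V (S t x)) atTop (𝓝 (c k)) := by
  obtain ⟨y, hy, t, ht, hty⟩ := exists_tendsto_of_mem_basin h.isCompact hx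
  have hanti := hV.toIsMorseLyapunov.antitone h hM hx
  have hyb := h.subset_basin hy
  have hlim (s : ℝ≥0) : Tendsto (fun n => V (S (s + t n) x)) atTop (𝓝 (V (S s y))) := by
    have h1 : Tendsto (fun n => S (s + t n) x) atTop (𝓝[basin S 𝒜] (S s y)) := by
      refine tendsto_nhdsWithin_iff.2 ⟨?_, Eventually.of_forall fun n => map_mem_basin hx _⟩
      simp only [Flow.map_add]
      exact ((S.continuous_toFun s).tendsto y).comp hty
    exact (hV.continuousOn _ (map_mem_basin hyb s)).tendsto.comp h1
  have hVy : Tendsto (fun t => V (S t x)) atTop (𝓝 (V y)) := by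
    have h0 : Tendsto (fun n => V (S (t n) x)) atTop (𝓝 (V y)) := by simpa using hlim 0
    have hle (s : ℝ≥0) : V y ≤ V (S s x) :=
      le_of_tendsto h0 ((ht.eventually_ge_atTop s).mono fun n hn => hanti hn)
    have hb : BddBelow (range fun t => V (S t x)) := ⟨V y, by rintro _ ⟨s, rfl⟩; exact hle s⟩
    have h2 := tendsto_atTop_ciInf hanti hb
    rwa [tendsto_nhds_unique (h2.comp ht) h0] at h2
  -- Both sides are limits of `V` along the orbit of `x`; strict decrease would separate them unless
  -- `y` is in a Morse set.
  have heq : V (S 1 y) = V y :=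
    tendsto_nhds_unique (hlim 1) (hVy.comp (tendsto_atTop_mono (fun n => le_add_self (a := t n) (b := 1)) ht))
  have hyM : y ∈ ⋃ k, M k := by
    by_contra hyM
    exact (hV.decreasing y hyb hyM 1 one_pos).ne heq
  obtain ⟨k, hk⟩ := mem_iUnion.1 hyM
  rw [hV.value k y hk] at hVy
  refine ⟨k, ?_, hVy⟩
  simpa using hanti.le_of_tendsto hVy 0

/-- On the orbit of a point of the level set, `V` would descend to some `c k ≤ r`. -/
theorem IsStrictMorseLyapunov.level_eq_empty (h : IsAttractor S 𝒜)
    (hM : IsMorseDecomposition S 𝒜 M) (hV : IsStrictMorseLyapunov S 𝒜 M V c) {r : ℝ}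
    (hr : ∀ k, r < c k) : level S 𝒜 V r = ∅ := by
  refine eq_empty_of_forall_notMem fun x hx => ?_
  obtain ⟨k, hk, -⟩ := hV.exists_tendsto h hM hx.1
  exact (hr k).not_ge (hk.trans hx.2)

/-- If there is no generalized critical value in `[r, s]`, then the flow pushes `V_s` into `V_r`
after a time that can be chosen to depend continuously on the point. -/
theorem IsStrictMorseLyapunov.exists_continuous_time (h : IsAttractor S 𝒜)
    (hM : IsMorseDecomposition S 𝒜 M) (hV : IsStrictMorseLyapunov S 𝒜 M V c) {r s : ℝ}
    (hc : ∀ k, c k ∉ Icc r s) :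
    ∃ τ : level S 𝒜 V s → ℝ≥0, Continuous τ ∧ ∀ x, V (S (τ x) x) ≤ r := by
  -- The admissible times form an up-set, hence are convex. The strict bound `< r` is open, so one
  -- time serves a whole neighbourhood, and local choices are averaged by a partition of unity.
  have hconv (x : level S 𝒜 V s) :
      Convex ℝ {t : ℝ | 0 ≤ t ∧ V (S t.toNNReal x) < r} := by
    refine OrdConnected.convex ⟨fun t ht t' _ p hp => ⟨ht.1.trans hp.1, ?_⟩⟩
    exact (hV.toIsMorseLyapunov.antitone h hM x.2.1 (Real.toNNReal_mono hp.1)).trans_lt ht.2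
  have hloc (x : level S 𝒜 V s) :
      ∃ t : ℝ, ∀ᶠ y : level S 𝒜 V s in 𝓝 x, t ∈ {t : ℝ | 0 ≤ t ∧ V (S t.toNNReal y) < r} := by
    obtain ⟨k, hk, hlim⟩ := hV.exists_tendsto h hM x.2.1
    have hkr : c k < r := not_le.1 fun hr => hc k ⟨hr, hk.trans x.2.2⟩
    obtain ⟨t, ht⟩ := (hlim.eventually_lt_const hkr).exists
    refine ⟨t, ?_⟩
    have hcont : Continuous fun y : level S 𝒜 V s => V (S t y) :=
      hV.continuousOn.comp_continuous
        ((S.continuous_toFun t).comp continuous_subtype_val) fun y => map_mem_basin y.2.1 t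
    filter_upwards [(hcont.tendsto x).eventually_lt_const ht] with y hy
    exact ⟨t.2, by simpa using hy⟩
  obtain ⟨g, hg⟩ := exists_continuous_forall_mem_convex_of_local_const hconv hloc
  exact ⟨fun x => (g x).toNNReal, by fun_prop, fun x => (hg x).2.le⟩

/-- Crossing no generalized critical value does not change the homology of the level sets. -/
theorem IsStrictMorseLyapunov.rank_homology_level_eq (R : Type v) [CommRing R] (G : Type u)
    [AddCommGroup G] [Module R G] (h : IsAttractor S 𝒜)
    (hM : IsMorseDecomposition S 𝒜 M) (hV : IsStrictMorseLyapunov S 𝒜 M V c) {r s : ℝ}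
    (hc : ∀ k, c k < r ↔ c k < s) (hr : ∀ k, c k ≠ r) (hs : ∀ k, c k ≠ s) (q : ℕ) :
    Module.rank R (homology R G q (level S 𝒜 V r)) =
      Module.rank R (homology R G q (level S 𝒜 V s)) := by
  -- Isolating intervals of neighbouring values may overlap, so the order of `r` and `s` is not
  -- known in the application.
  wlog hrs : r ≤ s generalizing r s
  · exact (this (fun k => (hc k).symm) hs hr (le_of_not_ge hrs)).symm
  obtain ⟨τ, hτ, hτr⟩ := hV.exists_continuous_time h hM (r := r) (s := s)
    fun k hk => hk.1.not_gt ((hc k).2 (hk.2.lt_of_ne (hs k)))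
  have hle {x : X} (hx : x ∈ basin S 𝒜) (t : ℝ≥0) : V (S t x) ≤ V x := by
    simpa using hV.toIsMorseLyapunov.antitone h hM hx (zero_le (a := t))
  let H : C(unitInterval × level S 𝒜 V s, level S 𝒜 V s) :=
    { toFun := fun p => ⟨S (Real.toNNReal p.1 * τ p.2) p.2,
        map_mem_basin p.2.2.1 _, (hle p.2.2.1 _).trans p.2.2.2⟩
      continuous_toFun := by
        refine Continuous.subtype_mk (S.continuous ?_ (by fun_prop)) _
        fun_prop }
  refine rank_homology_eq_of_homotopy R G (level_mono S 𝒜 V hrs) H (fun x => ?_) (fun x => ?_)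
    (fun t x hx => ?_) q
  · exact Subtype.ext (by simp [H])
  · exact ⟨map_mem_basin x.2.1 _, by simpa [H] using hτr x⟩
  · exact ⟨map_mem_basin x.2.1 _, (hle x.2.1 _).trans hx.2⟩

end Dynamics

end MorseAttractor

namespace MorseAttractor

/-! ### From inequalities to the equation. -/

section Series

theorem sum_range_succ_eq_alternatingSum (f : ℕ → ℤ) (n : ℕ) :
    ∑ q ∈ Finset.range (n + 1), (-1 : ℤ) ^ q * f q = (-1) ^ n * alternatingSum f n := by
  induction n with
  | zero => simp
  | succ n ih => rw [Finset.sum_range_succ, ih, alternatingSum_succ, pow_succ]; ring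

theorem alternatingSum_sum {ι : Type*} (s : Finset ι) (f : ι → ℕ → ℤ) (q : ℕ) :
    alternatingSum (fun j => ∑ k ∈ s, f k j) q = ∑ k ∈ s, alternatingSum (f k) q := by
  simp only [alternatingSum, Finset.mul_sum]
  exact Finset.sum_comm

/-- The Morse inequalities imply the Morse equation. -/
theorem tendsto_of_alternatingSum_le {β m : ℕ → ℕ}
    (h : ∀ q, alternatingSum (fun j => (β j : ℤ)) q ≤ alternatingSum (fun j => (m j : ℤ)) q)
    {s : ℝ} (hm : Tendsto (fun n : ℕ => ∑ q ∈ Finset.range n, (-1 : ℝ) ^ q * (m q : ℝ))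
      atTop (𝓝 s)) :
    Tendsto (fun n : ℕ => ∑ q ∈ Finset.range n, (-1 : ℝ) ^ q * (β q : ℝ)) atTop (𝓝 s) := by
  have hterm : Tendsto (fun q : ℕ => (-1 : ℝ) ^ q * (m q : ℝ)) atTop (𝓝 0) := by
    have := (hm.comp (tendsto_add_atTop_nat 1)).sub hm
    simpa [Function.comp_def, Finset.sum_range_succ] using this
  -- Natural numbers tending to `0` are eventually `0`.
  have hzero : ∀ᶠ q in atTop, m q = 0 := by
    filter_upwards [hterm.norm.eventually_lt_const (u := 1) (by simp)] with q hq
    have : (m q : ℝ) < 1 := by simpa using hq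
    exact Nat.lt_one_iff.1 (by exact_mod_cast this)
  obtain ⟨N, hN⟩ := eventually_atTop.1 hzero
  -- With `m (q + 1) = 0`, the inequalities in degrees `q` and `q + 1` bound the same difference
  -- from opposite sides, leaving `β (q + 1) ≤ 0`.
  have hβ (q : ℕ) (hq : N ≤ q) : β (q + 1) = 0 := by
    have h1 := h q
    have h2 := h (q + 1)
    rw [alternatingSum_succ, alternatingSum_succ, hN (q + 1) (by omega)] at h2
    omega
  have heq (q : ℕ) (hq : N ≤ q) :
      alternatingSum (fun j => (β j : ℤ)) q = alternatingSum (fun j => (m j : ℤ)) q := by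
    have h2 := h (q + 1)
    rw [alternatingSum_succ, alternatingSum_succ, hN (q + 1) (by omega), hβ q hq] at h2
    exact (h q).antisymm (by simpa using h2)
  refine hm.congr' ?_
  filter_upwards [eventually_ge_atTop (N + 1)] with n hn
  obtain ⟨q, rfl⟩ : ∃ q, n = q + 1 := ⟨n - 1, by omega⟩
  have := (sum_range_succ_eq_alternatingSum (fun j => (m j : ℤ)) q).trans
    ((heq q (by omega)) ▸ (sum_range_succ_eq_alternatingSum (fun j => (β j : ℤ)) q).symm)
  exact_mod_cast this

end Series

/-! ### Induction over the critical values. -/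

section Critical

variable {X : Type u} [MetricSpace X] {S : Flow ℝ≥0 X} {𝒜 : Set X}
variable {l : ℕ} {M : Fin l → Set X} {V : X → ℝ} {c : Fin l → ℝ}

theorem Isolates.lt_left_iff {k : Fin l} {a b : ℝ} (h : Isolates c k a b) (hc : StrictMono c)
    (j : Fin l) : (c j < a ↔ j < k) ∧ c j ≠ a := by
  have hj (hjk : j < k) : c j < a := by
    by_contra! hja
    exact (hc hjk).ne (h.2.2 j ⟨hja, ((hc hjk).trans h.2.1).le⟩)
  refine ⟨⟨fun hja => hc.lt_iff_lt.1 (hja.trans h.1), hj⟩, fun hja => ?_⟩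
  exact (hj (hc.lt_iff_lt.1 (hja.trans_lt h.1))).ne hja

theorem Isolates.lt_right_iff {k : Fin l} {a b : ℝ} (h : Isolates c k a b) (hc : StrictMono c)
    (j : Fin l) : (c j < b ↔ j ≤ k) ∧ c j ≠ b := by
  have hj (hkj : k < j) : b < c j := by
    by_contra! hjb
    exact (hc hkj).ne' (h.2.2 j ⟨(h.1.trans (hc hkj)).le, hjb⟩)
  refine ⟨⟨fun hjb => not_lt.1 fun hkj => (hj hkj).not_gt hjb,
    fun hjk => (hc.monotone hjk).trans_lt h.2.1⟩, fun hjb => ?_⟩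
  exact (hj (hc.lt_iff_lt.1 (h.2.1.trans_eq hjb.symm))).ne' hjb

/-- The Morse inequalities for a level set above exactly the first `n` critical values. -/
theorem IsStrictMorseLyapunov.morse_inequality_level (R : Type v) [CommRing R] [IsDomain R]
    (G : Type u) [AddCommGroup G] [Module R G] (h : IsAttractor S 𝒜)
    (hM : IsMorseDecomposition S 𝒜 M) (hV : IsStrictMorseLyapunov S 𝒜 M V c)
    {a b : Fin l → ℝ} (hab : ∀ k, Isolates c k (a k) (b k))
    (hfin : ∀ k q, Module.rank R (criticalGroup R G S 𝒜 V (hab k) q) < ℵ₀)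
    (n : ℕ) (hn : n ≤ l) (e : ℝ) (he : ∀ j, (c j < e ↔ j.1 < n) ∧ c j ≠ e) :
    (∀ q, Module.rank R (homology R G q (level S 𝒜 V e)) < ℵ₀) ∧
      ∀ q, alternatingSum (fun j => (betti R G S 𝒜 V e j : ℤ)) q ≤
        ∑ k : Fin l with k.1 < n, alternatingSum
          (fun j => (Module.finrank R (criticalGroup R G S 𝒜 V (hab k) j) : ℤ)) q := by
  induction n generalizing e with
  | zero =>
    have hempty : level S 𝒜 V e = ∅ := hV.level_eq_empty h hM fun k =>
      lt_of_le_of_ne (not_lt.1 fun hk => by simpa using (he k).1.1 hk) (he k).2.symm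
    have hrank := rank_homology_empty R G (X := X)
    have hβ (q : ℕ) : betti R G S 𝒜 V e q = 0 := by
      rw [betti, hempty, Module.finrank, hrank, _root_.map_zero]
    refine ⟨fun q => ?_, fun q => by simp [hβ, alternatingSum]⟩
    rw [hempty, hrank]
    exact Cardinal.aleph0_pos
  | succ n ih =>
    -- Indices start at `0`: `a k` lies above exactly `n` critical values and `b k` above `n + 1`,
    -- as does `e`. The induction hypothesis applies at `a k`, and `b k` is exchanged for `e` by
    -- deformation.
    let k : Fin l := ⟨n, hn⟩
    have hl := (hab k).lt_left_iff hV.strictMono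
    have hr := (hab k).lt_right_iff hV.strictMono
    obtain ⟨fa, ia⟩ := ih (by omega) (a k) hl
    obtain ⟨fb, ib⟩ := homology_rank_of_pair R G (level_mono S 𝒜 V (hab k).le) fa (hfin k)
    have hbe := hV.rank_homology_level_eq R G h hM (r := b k) (s := e)
      (fun j => (hr j).1.trans (Iff.trans Nat.lt_succ_iff.symm (he j).1.symm))
      (fun j => (hr j).2) (fun j => (he j).2)
    refine ⟨fun q => hbe q ▸ fb q, fun q => ?_⟩
    have hfilter : (Finset.univ.filter fun j : Fin l => j.1 < n + 1) =
        insert k (Finset.univ.filter fun j : Fin l => j.1 < n) := by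
      ext j
      simp [k, Fin.ext_iff, Nat.le_iff_lt_or_eq, or_comm]
    rw [hfilter, Finset.sum_insert (by simp [k])]
    simp only [betti, Module.finrank, ← hbe]
    exact (ib q).trans ((add_comm _ _).trans_le (add_le_add_right (ia q) _))

end Critical

end MorseAttractor
theorem theoremt
    (R : Type v) [CommRing R] [IsDomain R] (G : Type u) [AddCommGroup G] [Module R G]
    {X : Type u} [MetricSpace X] [CompleteSpace X]
    (S : Flow ℝ≥0 X) (hS : MorseAttractor.AsymptoticallyCompact S)
    (𝒜 : Set X) (h𝒜 : MorseAttractor.IsAttractor S 𝒜)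
    {l : ℕ} (M : Fin l → Set X) (hM : MorseAttractor.IsMorseDecomposition S 𝒜 M)
    (V : X → ℝ) (c : Fin l → ℝ) (hV : MorseAttractor.IsStrictMorseLyapunov S 𝒜 M V c)
    (a b : Fin l → ℝ) (hab : ∀ k, MorseAttractor.Isolates c k (a k) (b k))
    (d : ℝ) (hd : ∀ k, c k < d)
    (hfin : ∀ (k : Fin l) (q : ℕ),
      Module.rank R (MorseAttractor.criticalGroup R G S 𝒜 V (hab k) q) < ℵ₀) :
    (∀ q : ℕ,
      Module.rank R (MorseAttractor.homology R G q (MorseAttractor.level S 𝒜 V d)) < ℵ₀) ∧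
    (∀ q : ℕ,
      ∑ j ∈ Finset.range (q + 1),
          (-1 : ℤ) ^ (q - j) * (MorseAttractor.betti R G S 𝒜 V d j : ℤ) ≤
        ∑ j ∈ Finset.range (q + 1),
          (-1 : ℤ) ^ (q - j) * (MorseAttractor.morseNumber R G S 𝒜 V hab j : ℤ)) ∧
    (∀ s : ℝ,
      Tendsto (fun n : ℕ => ∑ q ∈ Finset.range n,
        (-1 : ℝ) ^ q * (MorseAttractor.morseNumber R G S 𝒜 V hab q : ℝ)) atTop (𝓝 s) →
      Tendsto (fun n : ℕ => ∑ q ∈ Finset.range n,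
        (-1 : ℝ) ^ q * (MorseAttractor.betti R G S 𝒜 V d q : ℝ)) atTop (𝓝 s)) := by
  have key := hV.morse_inequality_level R G h𝒜 hM hab hfin l le_rfl d
    fun j => ⟨by simp [hd j], (hd j).ne⟩
  have hineq (q : ℕ) : MorseAttractor.alternatingSum
        (fun j => (MorseAttractor.betti R G S 𝒜 V d j : ℤ)) q ≤
      MorseAttractor.alternatingSum
        (fun j => (MorseAttractor.morseNumber R G S 𝒜 V hab j : ℤ)) q := by
    simpa [MorseAttractor.morseNumber, MorseAttractor.alternatingSum_sum] using key.2 q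
  exact ⟨key.1, hineq, fun s => MorseAttractor.tendsto_of_alternatingSum_le hineq⟩
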